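/- Fix a universal machine $U$, that is, a partial computable function $U$ on $\{0,1\}^*$ such that for every partial computable function $M$ on $\{0,1\}^*$ there are a computable $t:\{0,1\}^*\to\{0,1\}^*$ and a constant $c$ with $M(p)=U(t(p))$ (one side is defined if and only if the other is) and $|t(p)|\le |p|+c$ for all $p\in\{0,1\}^*$. Let $C(x)=\min\{|p| : U(p)=x\}$ be the plain Kolmogorov complexity of the string $x$, and let $\log$ denote the logarithm to base $2$. Then there is a computable function $f$ that, given $x\in\{0,1\}^*$ and a rational number $\delta>0$, returns a nonempty finite list $f(x,\delta)$ (repetitions allowed) of strings, all of length $|x|$, such that: 1. The size of the list is $O(|x|^2)\cdot\mathrm{poly}(1/\delta)$: there is a polynomial $P$, not depending on $x$ and $\delta$, such that $f(x,\delta)$ has at most $|x|^2\cdot P(1/\delta)$ elements, for every nonempty string $x$ and every rational $\delta>0$. 2. For every rational $\delta>0$ there is a constant $c_\delta$ such that for every string $x$ with $|x|\ge 2$ and $C(x)<|x|-\log\log|x|-c_\delta$, at least a $(1-\delta)$ fraction of the elements of the list $f(x,\delta)$ (counted with multiplicity) have Kolmogorov complexity larger than $C(x)$. -/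

import Mathlib

/-- A partial function `U` on binary strings is a *universal machine* if it is partial computable
and every partial computable function `M` on binary strings (every Turing machine) can be
translated into it: there is a computable translator `t`, increasing lengths by at most a
constant, such that `M p = U (t p)` for all `p` (one side is defined iff the other is). -/
structure IsUniversalMachine (U : List Bool →. List Bool) : Prop where
  partrec : Partrec U
  universal : ∀ M : List Bool →. List Bool, Partrec M →
    ∃ t : List Bool → List Bool, Computable t ∧
      (∀ p : List Bool, M p = U (t p)) ∧
      ∃ c : ℕ, ∀ p : List Bool, (t p).length ≤ p.length + c

/-- The plain Kolmogorov complexity of the string `x` with respect to the machine `U`: the least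
length of a program `p` such that `U` halts on `p` with output `x`. If `U` is universal then
every string has a program, so the infimum is a minimum. -/
noncomputable def kolmogorovComplexity (U : List Bool →. List Bool) (x : List Bool) : ℕ :=
  sInf {l : ℕ | ∃ p : List Bool, p.length = l ∧ x ∈ U p}

/-- The number of entries of the list `l`, counted with multiplicity, that have plain Kolmogorov
complexity (with respect to `U`) larger than that of `x`. -/
noncomputable def countMoreComplex (U : List Bool →. List Bool) (x : List Bool)
    (l : List (List Bool)) : ℕ :=
  open Classical in
  l.countP (fun y => decide (kolmogorovComplexity U x < kolmogorovComplexity U y))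

/-- A function of a binary string and a nonnegative rational number, with values in the lists of
binary strings, is computable if it is computable when the rational number is presented as a
fraction, by a numerator and a denominator. (The denominator `0` presents the number `0`.) -/
def ComputableListFunction (f : List Bool → ℚ → List (List Bool)) : Prop :=
  Computable (fun z : List Bool × ℕ × ℕ => f z.1 ((z.2.1 : ℚ) / (z.2.2 : ℚ)))

/-! The list is the set of translates of `x` by a fixed small-biased list `L` of strings of length
`n = |x|`, with bias `2 ^ (-(2j + 1))` and `O(n ^ 2)` elements for fixed `j`. Call `x` exceptional
for `k` if at least a fraction `2 ^ (-j)` of its translates have complexity at most `k`. It suffices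
that no `x` sufficiently simpler than its length is exceptional for `k = C(x)`, where `2 ^ (-j) ≤
δ`.

Exceptional strings are rare. Translation by `L` acts on Fourier coefficients as multiplication by
character sums over `L`, which are small at nontrivial characters. Parseval then bounds the second
moment of the number of translates in a small set (`sum_translates_sq_le`), and
`card_many_translates_le` bounds the exceptional strings. Summed over all lengths, there are fewer
than `2 ^ (k - 2j)` of them (`card_exceptional_lt`).

Rare and enumerable means simple. Exceptional strings can be enumerated from `j` and `k`, so one is
described by its enumeration index in `k - 2j` bits and `j` in unary: its complexity is at most `k -
j + c` (`exists_complexity_exceptional_le`). If `C(x) = k` and `j > c` this is absurd. Since the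
enumeration runs over all lengths together, the length is not part of the description; the argument
loses only a constant depending on `δ`, and the double logarithm is not needed. -/

/-! ### Binary strings as a group, and the orthogonality of its characters. -/

/-- The inner product modulo 2 of two binary strings. -/
def dotBool : List Bool → List Bool → Bool
  | a :: s, b :: t => xor (a && b) (dotBool s t)
  | _, _ => false

/-- The binary strings of length `n`. -/
def binaryStrings : ℕ → List (List Bool)
  | 0 => [[]]
  | n + 1 => (binaryStrings n).map (List.cons false) ++ (binaryStrings n).map (List.cons true)

/-- The bitwise exclusive or of two binary strings. -/
def xorString (s t : List Bool) : List Bool := List.zipWith xor s t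

/-- The character `x ↦ (-1) ^ (s · x)` of the group of binary strings. -/
def chi (s t : List Bool) : ℤ := if dotBool s t then -1 else 1

theorem dotBool_comm : ∀ s t : List Bool, dotBool s t = dotBool t s
  | a :: s, b :: t => by simp [dotBool, dotBool_comm s t, Bool.and_comm]
  | [], [] => rfl
  | [], _ :: _ => rfl
  | _ :: _, [] => rfl

theorem chi_comm (s t : List Bool) : chi s t = chi t s := by simp [chi, dotBool_comm s t]

theorem chi_cons (a b : Bool) (s t : List Bool) :
    chi (a :: s) (b :: t) = (if a && b then -1 else 1) * chi s t := by
  simp only [chi, dotBool]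
  by_cases h : dotBool s t = true <;> cases a <;> cases b <;> simp [h]

theorem chi_sq (s t : List Bool) : chi s t * chi s t = 1 := by
  unfold chi; split_ifs <;> rfl

theorem mem_binaryStrings : ∀ {n : ℕ} {s : List Bool}, s ∈ binaryStrings n ↔ s.length = n
  | 0, s => by simp [binaryStrings]
  | n + 1, [] => by simp [binaryStrings]
  | n + 1, a :: s => by
    simp only [binaryStrings, List.mem_append, List.mem_map, List.length_cons]
    cases a <;> simp [mem_binaryStrings]

theorem nodup_binaryStrings : ∀ n : ℕ, (binaryStrings n).Nodup
  | 0 => by simp [binaryStrings]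
  | n + 1 => by
    have h := nodup_binaryStrings n
    rw [binaryStrings, List.nodup_append]
    refine ⟨h.map (List.cons_injective), h.map (List.cons_injective), ?_⟩
    simp

theorem length_xorString {n : ℕ} {s t : List Bool} (hs : s.length = n) (ht : t.length = n) :
    (xorString s t).length = n := by
  simp [xorString, hs, ht]

theorem xorString_cancel : ∀ {s t : List Bool}, s.length = t.length →
    xorString (xorString s t) t = s
  | [], _, _ => by simp [xorString]
  | a :: s, [], h => by simp at h
  | a :: s, b :: t, h => by
    have := @xorString_cancel s t (by simpa using h)
    simp only [xorString, List.zipWith_cons_cons, List.cons.injEq] at this ⊢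
    exact ⟨by simp, this⟩

theorem chi_xorString : ∀ {s t u : List Bool}, s.length = t.length → u.length = t.length →
    chi u (xorString s t) = chi u s * chi u t
  | [], [], [], _, _ => by simp [chi, dotBool]
  | a :: s, b :: t, c :: u, h, h' => by
    have := @chi_xorString s t u (by simpa using h) (by simpa using h')
    simp only [xorString, List.zipWith_cons_cons, chi_cons] at this ⊢
    rw [this]
    cases a <;> cases b <;> cases c <;> simp
  | [], _ :: _, _, h, _ => by simp at h
  | _ :: _, [], _, h, _ => by simp at h
  | _, [], _ :: _, _, h => by simp at h
  | _, _ :: _, [], _, h => by simp at h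

theorem true_mem_xorString : ∀ {s t : List Bool}, s.length = t.length →
    (true ∈ xorString s t ↔ s ≠ t)
  | [], [], _ => by simp [xorString]
  | a :: s, b :: t, h => by
    have := @true_mem_xorString s t (by simpa using h)
    simp only [xorString, List.zipWith_cons_cons, List.mem_cons] at this ⊢
    rw [this]
    cases a <;> cases b <;> simp
  | [], _ :: _, h => by simp at h
  | _ :: _, [], h => by simp at h

/-- Splitting by the first bit of `t`, the two halves cancel if `s` starts with a one and agree
otherwise. -/
theorem sum_chi_list : ∀ {n : ℕ} {s : List Bool}, s.length = n →
    ((binaryStrings n).map (fun t => chi t s)).sum = if true ∈ s then 0 else 2 ^ n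
  | 0, s, h => by
    obtain rfl : s = [] := by simpa using h
    simp [binaryStrings, chi, dotBool]
  | n + 1, [], h => by simp at h
  | n + 1, a :: s, h => by
    have := @sum_chi_list n s (by simpa using h)
    simp only [binaryStrings, List.map_append, List.map_map, List.sum_append, Function.comp_def,
      chi_cons, List.sum_map_mul_left, this]
    cases a
    · by_cases hs : true ∈ s <;> simp [hs, pow_succ, mul_two]
    · by_cases hs : true ∈ s <;> simp [hs]

theorem sum_chi {n : ℕ} {s : List Bool} (h : s.length = n) :
    ∑ t ∈ (binaryStrings n).toFinset, chi t s = if true ∈ s then 0 else 2 ^ n := by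
  rw [List.sum_toFinset _ (nodup_binaryStrings n), sum_chi_list h]

theorem card_binaryStrings (n : ℕ) : (binaryStrings n).length = 2 ^ n := by
  induction n with
  | zero => rfl
  | succ n ih => simp [binaryStrings, ih, pow_succ, mul_two]

theorem sum_chi_mul_chi {n : ℕ} {s t : List Bool} (hs : s.length = n) (ht : t.length = n) :
    ∑ u ∈ (binaryStrings n).toFinset, chi u s * chi u t = if s = t then 2 ^ n else 0 := by
  have : ∀ u ∈ (binaryStrings n).toFinset, chi u s * chi u t = chi u (xorString s t) := by
    intro u hu
    rw [List.mem_toFinset, mem_binaryStrings] at hu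
    rw [chi_xorString (hs.trans ht.symm) (hu.trans ht.symm)]
  rw [Finset.sum_congr rfl this, sum_chi (length_xorString hs ht)]
  have := true_mem_xorString (hs.trans ht.symm)
  by_cases h : s = t <;> simp_all

/-! ### Fourier analysis of translates and the second moment method. -/

/-- Parseval's identity on the group of binary strings of length `n`. -/
theorem sum_fourier_sq (n : ℕ) (h : List Bool → ℤ) :
    ∑ t ∈ (binaryStrings n).toFinset, (∑ x ∈ (binaryStrings n).toFinset, h x * chi t x) ^ 2 =
      2 ^ n * ∑ x ∈ (binaryStrings n).toFinset, h x ^ 2 := by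
  calc _ = ∑ t ∈ (binaryStrings n).toFinset, ∑ x ∈ (binaryStrings n).toFinset,
        ∑ y ∈ (binaryStrings n).toFinset, h x * h y * (chi t x * chi t y) := by
        refine Finset.sum_congr rfl fun t _ => ?_
        rw [sq, Finset.sum_mul_sum]
        exact Finset.sum_congr rfl fun x _ => Finset.sum_congr rfl fun y _ => by ring
    _ = ∑ x ∈ (binaryStrings n).toFinset, ∑ y ∈ (binaryStrings n).toFinset,
        h x * h y * ∑ t ∈ (binaryStrings n).toFinset, (chi t x * chi t y) := by
        rw [Finset.sum_comm]
        refine Finset.sum_congr rfl fun x _ => ?_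
        rw [Finset.sum_comm]
        simp only [Finset.mul_sum]
    _ = ∑ x ∈ (binaryStrings n).toFinset, h x ^ 2 * 2 ^ n := by
        refine Finset.sum_congr rfl fun x hx => ?_
        have hx' := hx
        rw [List.mem_toFinset, mem_binaryStrings] at hx'
        rw [Finset.sum_eq_single_of_mem x hx]
        · rw [sum_chi_mul_chi hx' hx', if_pos rfl]; ring
        · intro y hy hne
          rw [List.mem_toFinset, mem_binaryStrings] at hy
          rw [sum_chi_mul_chi hx' hy, if_neg (Ne.symm hne), mul_zero]
    _ = _ := by rw [Finset.mul_sum]; exact Finset.sum_congr rfl fun x _ => by ring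

theorem sum_xorString {n : ℕ} {s : List Bool} (hs : s.length = n) (g : List Bool → ℤ) :
    ∑ x ∈ (binaryStrings n).toFinset, g (xorString x s) =
      ∑ x ∈ (binaryStrings n).toFinset, g x := by
  refine Finset.sum_nbij' (fun x => xorString x s) (fun x => xorString x s) ?_ ?_ ?_ ?_ ?_
  · intro x hx
    rw [List.mem_toFinset, mem_binaryStrings] at hx ⊢
    exact length_xorString hx hs
  · intro x hx
    rw [List.mem_toFinset, mem_binaryStrings] at hx ⊢
    exact length_xorString hx hs
  · intro x hx
    rw [List.mem_toFinset, mem_binaryStrings] at hx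
    exact xorString_cancel (hx.trans hs.symm)
  · intro x hx
    rw [List.mem_toFinset, mem_binaryStrings] at hx
    exact xorString_cancel (hx.trans hs.symm)
  · intro x _; rfl

theorem chi_eq_one_of_true_notMem {t s : List Bool} (h : true ∉ t) : chi t s = 1 := by
  induction t generalizing s with
  | nil => simp [chi, dotBool]
  | cons a t ih =>
    cases s with
    | nil => simp [chi, dotBool]
    | cons b s =>
      simp only [List.mem_cons, not_or] at h
      rw [chi_cons, ih h.2]
      cases a <;> simp_all

/-- The Fourier transform turns translation by the elements of a list into multiplication. -/
theorem fourier_translates {n : ℕ} {L : List (List Bool)} (hL : ∀ s ∈ L, s.length = n)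
    (g : List Bool → ℤ) {t : List Bool} (ht : t.length = n) :
    ∑ x ∈ (binaryStrings n).toFinset, (L.map fun s => g (xorString x s)).sum * chi t x =
      (L.map (chi t)).sum * ∑ x ∈ (binaryStrings n).toFinset, g x * chi t x := by
  induction L with
  | nil => simp
  | cons s L ih =>
    have hs := hL s (by simp)
    simp only [List.map_cons, List.sum_cons, add_mul, Finset.sum_add_distrib]
    rw [ih fun u hu => hL u (by simp [hu])]
    congr 1
    rw [Finset.mul_sum, ← sum_xorString hs (fun x => chi t s * (g x * chi t x))]
    refine Finset.sum_congr rfl fun x hx => ?_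
    rw [List.mem_toFinset, mem_binaryStrings] at hx
    rw [chi_xorString (hx.trans hs.symm) (ht.trans hs.symm)]
    linear_combination (-(g (xorString x s) * chi t x)) * chi_sq t s

/-- A second moment bound for the number of the translates of a string that lie in a given set. -/
theorem sum_translates_sq_le {n : ℕ} {L : List (List Bool)} (hL : ∀ s ∈ L, s.length = n) (E : ℕ)
    (hE : ∀ t : List Bool, t.length = n → true ∈ t → E * |(L.map (chi t)).sum| ≤ L.length)
    (B : Finset (List Bool)) (hB : B ⊆ (binaryStrings n).toFinset) :
    (E : ℤ) ^ 2 * (2 ^ n * ∑ x ∈ (binaryStrings n).toFinset,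
      (L.map fun s => if xorString x s ∈ B then (1 : ℤ) else 0).sum ^ 2) ≤
      (L.length : ℤ) ^ 2 * ((E : ℤ) ^ 2 * (B.card : ℤ) ^ 2 + 2 ^ n * B.card) := by
  set g : List Bool → ℤ := fun y => if y ∈ B then 1 else 0 with hg
  set V := (binaryStrings n).toFinset with hV
  have hgsum : ∑ x ∈ V, g x = B.card := by
    simp only [hg, Finset.sum_ite_mem, Finset.inter_eq_right.2 hB]
    simp
  have hgsq : ∑ x ∈ V, g x ^ 2 = B.card := by
    rw [← hgsum]
    refine Finset.sum_congr rfl fun x _ => ?_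
    simp only [hg]; split_ifs <;> rfl
  set z : List Bool := List.replicate n false with hz
  have hzV : z ∈ V := by simp [hV, mem_binaryStrings, hz]
  rw [← sum_fourier_sq n, Finset.mul_sum]
  -- At a nontrivial frequency the bias bound absorbs `E ^ 2`. The trivial frequency `z` gives the
  -- main term, the squared mean.
  have key : ∀ t ∈ V, (E : ℤ) ^ 2 * (∑ x ∈ V, (L.map fun s => g (xorString x s)).sum * chi t x) ^ 2
      ≤ (if t = z then (E : ℤ) ^ 2 * (L.length : ℤ) ^ 2 * (B.card : ℤ) ^ 2 else 0) +
        (L.length : ℤ) ^ 2 * (∑ x ∈ V, g x * chi t x) ^ 2 := by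
    intro t ht
    rw [hV, List.mem_toFinset, mem_binaryStrings] at ht
    rw [fourier_translates hL g ht, mul_pow]
    by_cases h1 : true ∈ t
    · have hne : t ≠ z := by
        rintro rfl
        simp [hz] at h1
      rw [if_neg hne, zero_add, ← mul_assoc]
      refine mul_le_mul_of_nonneg_right ?_ (sq_nonneg _)
      rw [← mul_pow, ← sq_abs]
      refine pow_le_pow_left₀ (abs_nonneg _) ?_ 2
      rw [abs_mul, Nat.abs_cast]
      exact hE t ht h1
    · have htz : t = z := by
        rw [hz, List.eq_replicate_iff]
        exact ⟨ht, fun b hb => by cases b <;> simp_all⟩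
      rw [if_pos htz]
      have h2 : (L.map (chi t)).sum = L.length := by
        have : L.map (chi t) = L.map fun _ => (1 : ℤ) :=
          List.map_congr_left fun s _ => chi_eq_one_of_true_notMem h1
        rw [this]; simp
      have h3 : ∑ x ∈ V, g x * chi t x = B.card := by
        rw [← hgsum]
        exact Finset.sum_congr rfl fun x _ => by rw [chi_eq_one_of_true_notMem h1, mul_one]
      rw [h2, h3]
      nlinarith [sq_nonneg ((L.length : ℤ) * B.card)]
  refine (Finset.sum_le_sum key).trans ?_
  rw [Finset.sum_add_distrib, Finset.sum_ite_eq' V z, if_pos hzV, ← Finset.mul_sum,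
    sum_fourier_sq, hgsq]
  apply le_of_eq; ring

/-- Few strings have a large fraction of their translates in a small set. -/
theorem card_many_translates_le {n j : ℕ} {L : List (List Bool)} (hL : ∀ s ∈ L, s.length = n)
    (hne : L ≠ []) {E : ℕ}
    (hE : ∀ t : List Bool, t.length = n → true ∈ t → E * |(L.map (chi t)).sum| ≤ L.length)
    (B : Finset (List Bool)) (hB : ∀ y ∈ B, y.length = n) (hEB : E ^ 2 * B.card ≤ 2 ^ n)
    (T : Finset (List Bool))
    (hT : ∀ x ∈ T, x.length = n ∧
      L.length ≤ 2 ^ j * (L.map fun s => if xorString x s ∈ B then (1 : ℤ) else 0).sum) :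
    E ^ 2 * T.card ≤ 2 * 4 ^ j * B.card := by
  have hBV : B ⊆ (binaryStrings n).toFinset := fun y hy => by
    simp [mem_binaryStrings, hB y hy]
  have hTV : T ⊆ (binaryStrings n).toFinset := fun y hy => by
    simp [mem_binaryStrings, (hT y hy).1]
  have h1 := sum_translates_sq_le hL E hE B hBV
  have hD : (0 : ℤ) < (L.length : ℤ) := by
    have := List.length_pos_iff.2 hne
    exact_mod_cast this
  -- Chebyshev: each element of `T` contributes at least `(|L| / 2 ^ j) ^ 2` to the second moment.
  have h2 : (T.card : ℤ) * (L.length : ℤ) ^ 2 ≤ 4 ^ j * ∑ x ∈ (binaryStrings n).toFinset,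
      (L.map fun s => if xorString x s ∈ B then (1 : ℤ) else 0).sum ^ 2 := by
    rw [Finset.mul_sum]
    refine le_trans ?_ (Finset.sum_le_sum_of_subset_of_nonneg hTV
      fun x _ _ => mul_nonneg (by positivity) (sq_nonneg _))
    rw [← nsmul_eq_mul]
    refine Finset.card_nsmul_le_sum _ _ _ fun x hx => ?_
    have := pow_le_pow_left₀ hD.le (hT x hx).2 2
    refine this.trans (le_of_eq ?_)
    rw [mul_pow, ← pow_mul, mul_comm j 2, pow_mul]; norm_num
  have hN : (0 : ℤ) < 2 ^ n := by positivity
  have hEB' : (E : ℤ) ^ 2 * B.card ≤ 2 ^ n := by exact_mod_cast hEB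
  have h3 : ((2 : ℤ) ^ n * (L.length : ℤ) ^ 2) * ((E : ℤ) ^ 2 * T.card) ≤
      ((2 : ℤ) ^ n * (L.length : ℤ) ^ 2) * (2 * 4 ^ j * B.card) := by
    calc _ = (E : ℤ) ^ 2 * 2 ^ n * (T.card * (L.length : ℤ) ^ 2) := by ring
      _ ≤ _ := mul_le_mul_of_nonneg_left h2 (by positivity)
      _ = 4 ^ j * _ := by rw [mul_left_comm, mul_assoc]
      _ ≤ _ := mul_le_mul_of_nonneg_left h1 (by positivity)
      _ = 4 ^ j * (L.length : ℤ) ^ 2 * B.card * ((E : ℤ) ^ 2 * B.card + 2 ^ n) := by ring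
      -- For a set `B` this small the main term is dominated by the error term; hence the factor 2.
      _ ≤ 4 ^ j * (L.length : ℤ) ^ 2 * B.card * (2 ^ n + 2 ^ n) :=
        mul_le_mul_of_nonneg_left (by linarith) (by positivity)
      _ = _ := by ring
  have h4 := le_of_mul_le_mul_left h3 (by positivity)
  exact_mod_cast h4

/-! ### The powering construction of small-biased lists over a finite field. -/

open Polynomial in
/-- The polynomial with the coefficients given by a binary string. -/
noncomputable def bitPolynomial (F : Type*) [Field F] : List Bool → F[X]
  | [] => 0
  | c :: t => C (if c then 1 else 0) + X * bitPolynomial F t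

/-- The string of the values of `φ` at `b, a * b, …, a ^ (n - 1) * b`. -/
def powerString {F : Type*} [Field F] (φ : F → Bool) (a : F) : ℕ → F → List Bool
  | 0, _ => []
  | n + 1, b => φ b :: powerString φ a n (a * b)

section PowerString

variable {F : Type*} [Field F]

theorem length_powerString (φ : F → Bool) (a : F) : ∀ (n : ℕ) (b : F),
    (powerString φ a n b).length = n
  | 0, _ => rfl
  | n + 1, b => by simp [powerString, length_powerString φ a n]

/-- By additivity, the sum of the bits `φ (a ^ i * b)` selected by `t` is `φ` of the sum of those
powers times `b`. Characters thereby become polynomial evaluations. -/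
theorem dotBool_powerString {φ : F → Bool} (hφ : ∀ x y, φ (x + y) = xor (φ x) (φ y)) (a : F) :
    ∀ (t : List Bool) (b : F),
      dotBool t (powerString φ a t.length b) = φ (b * (bitPolynomial F t).eval a)
  | [], b => by
    have := hφ 0 0
    simp only [add_zero, bne_self_eq_false] at this
    simp [dotBool, bitPolynomial, this]
  | c :: t, b => by
    have h0 := hφ 0 0
    simp only [add_zero, bne_self_eq_false] at h0
    have hb : b * (bitPolynomial F (c :: t)).eval a =
        b * (if c then 1 else 0) + a * b * (bitPolynomial F t).eval a := by
      cases c <;> simp [bitPolynomial] <;> ring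
    rw [hb, hφ, ← dotBool_powerString hφ a t]
    cases c <;> simp [powerString, dotBool, h0]

theorem bitPolynomial_ne_zero : ∀ {t : List Bool}, true ∈ t → bitPolynomial F t ≠ 0
  | [], h => by simp at h
  | c :: t, h => by
    intro h0
    have hc : c = false := by
      have := congrArg (Polynomial.eval 0) h0
      cases c
      · rfl
      · simp [bitPolynomial] at this
    subst hc
    refine @bitPolynomial_ne_zero t (by simpa using h) ?_
    simpa [bitPolynomial] using h0

theorem natDegree_bitPolynomial_le : ∀ t : List Bool, (bitPolynomial F t).natDegree ≤ t.length
  | [] => by simp [bitPolynomial]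
  | c :: t => by
    rw [bitPolynomial, List.length_cons]
    refine Polynomial.natDegree_add_le_of_degree_le (by cases c <;> simp) ?_
    refine Polynomial.natDegree_mul_le.trans ?_
    have := natDegree_bitPolynomial_le t
    have := Polynomial.natDegree_X_le (R := F)
    omega

variable [Fintype F]

theorem sum_chi_powerString [DecidableEq F] {φ : F → Bool} (hφ : ∀ x y, φ (x + y) = xor (φ x) (φ y)) {u : F}
    (hu : φ u = true) (a : F) (t : List Bool) :
    ∑ b, chi t (powerString φ a t.length b) =
      if (bitPolynomial F t).eval a = 0 then (Fintype.card F : ℤ) else 0 := by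
  simp only [chi, dotBool_powerString hφ]
  have h0 := hφ 0 0
  simp only [add_zero, bne_self_eq_false] at h0
  split_ifs with h
  · simp [h, h0]
  · set v := (bitPolynomial F t).eval a
    -- Shifting `b` by `u * v⁻¹` adds `u` to `b * v` and flips every sign, so the sum is its own
    -- negative.
    have h1 : ∑ b : F, (if φ (b * v) then (-1 : ℤ) else 1) =
        ∑ b : F, -(if φ (b * v) then (-1 : ℤ) else 1) := by
      rw [← Equiv.sum_comp (Equiv.addRight (u * v⁻¹))]
      refine Finset.sum_congr rfl fun b _ => ?_
      have : (b + u * v⁻¹) * v = b * v + u := by field_simp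
      rw [Equiv.coe_addRight, this, hφ, hu]
      cases φ (b * v) <;> simp
    rw [Finset.sum_neg_distrib] at h1
    linarith

/-- Only roots `a` of the nonzero polynomial of `t` contribute, each with `|F|`, and their number is
bounded by the degree. -/
theorem abs_sum_chi_powerString_le [DecidableEq F] {φ : F → Bool}
    (hφ : ∀ x y, φ (x + y) = xor (φ x) (φ y)) {u : F} (hu : φ u = true) {t : List Bool}
    (ht : true ∈ t) :
    |∑ p : F × F, chi t (powerString φ p.1 t.length p.2)| ≤ Fintype.card F * t.length := by
  rw [Fintype.sum_prod_type]
  simp only [sum_chi_powerString hφ hu]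
  rw [← Finset.sum_filter, Finset.sum_const, nsmul_eq_mul, mul_comm, abs_mul, Nat.abs_cast,
    Nat.abs_cast]
  refine mul_le_mul_of_nonneg_left ?_ (by positivity)
  have hp := bitPolynomial_ne_zero (F := F) ht
  have h1 : (Finset.univ.filter fun a : F => (bitPolynomial F t).eval a = 0) ⊆
      (bitPolynomial F t).roots.toFinset := by
    intro a ha
    simpa [hp, Polynomial.IsRoot] using ha
  have h2 := (Finset.card_le_card h1).trans ((Multiset.toFinset_card_le _).trans
    ((Polynomial.card_roots' _).trans (natDegree_bitPolynomial_le t)))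
  exact_mod_cast h2

end PowerString

/-- There is a nonzero additive map from a field of characteristic 2 to the Booleans. -/
theorem exists_additive_to_bool (F : Type*) [Field F] [Algebra (ZMod 2) F] :
    ∃ φ : F → Bool, (∀ x y, φ (x + y) = xor (φ x) (φ y)) ∧ ∃ u, φ u = true := by
  obtain ⟨f, hf⟩ : ∃ f : Module.Dual (ZMod 2) F, f 1 ≠ 0 := by
    by_contra! h
    exact one_ne_zero ((Module.forall_dual_apply_eq_zero_iff (ZMod 2) (1 : F)).1 h)
  refine ⟨fun x => decide (f x ≠ 0), fun x y => ?_, 1, by simpa using hf⟩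
  simp only [map_add]
  generalize f x = a
  generalize f y = b
  revert a b
  decide

/-- The powering construction of small biased sets: there are `O(n² / ε²)` strings of length `n`
on which no nontrivial character has bias larger than `ε = 2 ^ (-e)`. -/
theorem exists_biased_list (n e : ℕ) :
    ∃ L : List (List Bool), L ≠ [] ∧ (∀ s ∈ L, s.length = n) ∧
      L.length ≤ (n + 1) ^ 2 * 4 ^ (e + 1) ∧
      ∀ t : List Bool, t.length = n → true ∈ t →
        (2 ^ e : ℤ) * |(L.map (chi t)).sum| ≤ L.length := by
  classical
  -- A field with `2 ^ m ≥ q` elements has bias at most `n / 2 ^ m ≤ 2 ^ (-e)`, and `2 ^ m ≤ 2 * q`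
  -- keeps the list of all pairs `(a, b)` short. Using `n + 1` keeps `q` positive when `n = 0`.
  set q := (n + 1) * 2 ^ e with hq
  have hq0 : 0 < q := by positivity
  set m := Nat.log 2 q + 1 with hm
  have h1 : q < 2 ^ m := Nat.lt_pow_succ_log_self (by norm_num) q
  have h2 : 2 ^ m ≤ 2 * q := by
    rw [hm, pow_succ, mul_comm]
    exact Nat.mul_le_mul_left 2 (Nat.pow_log_le_self 2 hq0.ne')
  let F := GaloisField 2 m
  have : Fintype F := Fintype.ofFinite F
  have hF : Fintype.card F = 2 ^ m := by
    rw [← Nat.card_eq_fintype_card]; exact GaloisField.card 2 m (by omega)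
  obtain ⟨φ, hφ, u, hu⟩ := exists_additive_to_bool F
  set L := (Finset.univ : Finset (F × F)).toList.map fun p => powerString φ p.1 n p.2 with hL
  have hlen : L.length = 2 ^ m * 2 ^ m := by
    simp [hL, hF]
  refine ⟨L, ?_, ?_, ?_, ?_⟩
  · rw [← List.length_pos_iff, hlen]; positivity
  · intro s hs
    obtain ⟨p, -, rfl⟩ := List.mem_map.1 hs
    exact length_powerString φ p.1 n p.2
  · rw [hlen]
    calc _ ≤ (2 * q) * (2 * q) := Nat.mul_le_mul h2 h2
      _ = _ := by
        rw [hq, show (4 : ℕ) = 2 * 2 from rfl, mul_pow]; ring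
  · rintro t rfl ht
    have h3 := abs_sum_chi_powerString_le hφ hu ht
    have h4 : (L.map (chi t)).sum = ∑ p : F × F, chi t (powerString φ p.1 t.length p.2) := by
      rw [hL, List.map_map, ← Finset.sum_map_toList]; rfl
    rw [h4, hlen]
    rw [hF] at h3
    have h5 : ((t.length + 1 : ℕ) : ℤ) * 2 ^ e ≤ 2 ^ m := by exact_mod_cast h1.le
    push_cast at h3 h5 ⊢
    calc _ ≤ (2 : ℤ) ^ e * (2 ^ m * t.length) := mul_le_mul_of_nonneg_left h3 (by positivity)
      _ = 2 ^ m * (t.length * 2 ^ e) := by ring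
      _ ≤ 2 ^ m * 2 ^ m := by
        refine mul_le_mul_of_nonneg_left ?_ (by positivity)
        nlinarith [show (0 : ℤ) < 2 ^ e by positivity]

/-! ### Computing small-biased lists by exhaustive search. -/

theorem Primrec.nat_pow : Primrec₂ ((· ^ ·) : ℕ → ℕ → ℕ) :=
  Primrec₂.unpaired'.1 Nat.Primrec.pow

/-- The fold carries the unread part of `t` and the parity so far. Once `t` is exhausted, `headI`
defaults to `false` and the parity stays fixed. -/
theorem dotBool_eq_foldl (s t : List Bool) :
    dotBool s t = (s.foldl (fun (u : List Bool × Bool) a =>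
      (u.1.tail, xor u.2 (a && u.1.headI))) (t, false)).2 := by
  suffices h : ∀ (s t : List Bool) (b : Bool), xor b (dotBool s t) =
      (s.foldl (fun (u : List Bool × Bool) a =>
        (u.1.tail, xor u.2 (a && u.1.headI))) (t, b)).2 by
    simpa using h s t false
  intro s
  induction s with
  | nil => simp [dotBool]
  | cons a s ih =>
    intro t b
    cases t with
    | nil =>
      rw [List.foldl_cons, ← ih]
      have : dotBool s [] = false := by cases s <;> rfl
      simp [dotBool, this]
    | cons c t =>
      rw [List.foldl_cons, ← ih]
      simp [dotBool]

theorem primrec_dotBool : Primrec₂ dotBool := by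
  refine Primrec₂.of_eq (f := fun s t => (s.foldl (fun (u : List Bool × Bool) a =>
      (u.1.tail, xor u.2 (a && u.1.headI))) (t, false)).2) ?_ fun s t =>
      (dotBool_eq_foldl s t).symm
  refine Primrec.snd.comp (Primrec.list_foldl
    (h := fun _ (r : (List Bool × Bool) × Bool) => (r.1.1.tail, xor r.1.2 (r.2 && r.1.1.headI)))
    Primrec.fst (Primrec.snd.pair (Primrec.const false)) ?_)
  have hu : Primrec fun q : (List Bool × List Bool) × (List Bool × Bool) × Bool => q.2.1.1 :=
    Primrec.fst.comp (Primrec.fst.comp Primrec.snd)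
  have hb : Primrec fun q : (List Bool × List Bool) × (List Bool × Bool) × Bool => q.2.1.2 :=
    Primrec.snd.comp (Primrec.fst.comp Primrec.snd)
  have ha : Primrec fun q : (List Bool × List Bool) × (List Bool × Bool) × Bool => q.2.2 :=
    Primrec.snd.comp Primrec.snd
  exact (Primrec.list_tail.comp hu).pair ((Primrec.dom_bool₂ xor).comp hb
    (Primrec.and.comp ha (Primrec.list_headI.comp hu)))

theorem primrec_binaryStrings : Primrec binaryStrings := by
  have hcons : ∀ b : Bool, Primrec (List.map (List.cons b)) := fun b =>
    Primrec.list_map Primrec.id (Primrec.list_cons.comp (Primrec.const b) Primrec.snd)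
  refine (Primrec.nat_rec₁ (f := fun _ M => M.map (List.cons false) ++ M.map (List.cons true))
    [[]] (Primrec.list_append.comp ((hcons false).comp Primrec.snd)
      ((hcons true).comp Primrec.snd))).of_eq fun n => ?_
  induction n with
  | zero => rfl
  | succ n ih => simp only [binaryStrings, ← ih]

theorem primrec_xorString : Primrec₂ xorString := by
  refine Primrec₂.of_eq (f := fun s t => (List.range (min s.length t.length)).map fun i =>
    xor (s.getD i false) (t.getD i false)) ?_ fun s t => ?_
  · refine Primrec.list_map (Primrec.list_range.comp (Primrec.nat_min.comp
      (Primrec.list_length.comp Primrec.fst) (Primrec.list_length.comp Primrec.snd))) ?_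
    exact (Primrec.dom_bool₂ xor).comp
      ((Primrec.list_getD false).comp (Primrec.fst.comp Primrec.fst) Primrec.snd)
      ((Primrec.list_getD false).comp (Primrec.snd.comp Primrec.fst) Primrec.snd)
  · refine List.ext_getElem (by simp [xorString]) fun i h1 h2 => ?_
    simp only [List.length_map, List.length_range, lt_min_iff] at h1
    simp [xorString, h1.1, h1.2]

/-- A decidable form of the condition that `L` is a short nonempty list of strings of length `n`
on which the nontrivial characters have bias at most `2 ^ (-e)`. -/
def IsShortBiasedList (p : ℕ × ℕ) (L : List (List Bool)) : Prop :=
  L.length ≠ 0 ∧ (∀ s ∈ L, s.length = p.1) ∧ L.length ≤ (p.1 + 1) ^ 2 * 4 ^ (p.2 + 1) ∧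
    ∀ t ∈ binaryStrings p.1, (∃ a ∈ t, a = true) →
      2 ^ p.2 * (2 * (L.filter fun s => dotBool s t = true).length) ≤
          (2 ^ p.2 + 1) * L.length ∧
        2 ^ p.2 * L.length ≤
          L.length + 2 ^ p.2 * (2 * (L.filter fun s => dotBool s t = true).length)

theorem sum_chi_eq (t : List Bool) (L : List (List Bool)) :
    (L.map (chi t)).sum =
      (L.length : ℤ) - 2 * ((L.filter fun s => dotBool s t = true).length : ℤ) := by
  induction L with
  | nil => simp
  | cons s L ih =>
    rw [List.map_cons, List.sum_cons, ih, chi_comm, chi]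
    by_cases h : dotBool s t = true
    · simp [h]; ring
    · simp [h]; ring

/-- The two inequalities in `IsShortBiasedList` are the two sides of the absolute value bound,
rearranged to avoid subtraction in `ℕ`. Since the condition is decidable and always satisfiable, a
search finds a list and no field arithmetic has to be shown computable. -/
theorem isShortBiasedList_iff (p : ℕ × ℕ) (L : List (List Bool)) :
    IsShortBiasedList p L ↔ L ≠ [] ∧ (∀ s ∈ L, s.length = p.1) ∧
      L.length ≤ (p.1 + 1) ^ 2 * 4 ^ (p.2 + 1) ∧
      ∀ t : List Bool, t.length = p.1 → true ∈ t →
        (2 ^ p.2 : ℤ) * |(L.map (chi t)).sum| ≤ L.length := by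
  unfold IsShortBiasedList
  refine and_congr (by simp) (and_congr Iff.rfl (and_congr Iff.rfl (forall_congr' fun t => ?_)))
  rw [mem_binaryStrings]
  refine imp_congr Iff.rfl (imp_congr (by simp) ?_)
  rw [sum_chi_eq]
  generalize (L.filter fun s => dotBool s t = true).length = c
  have h2 : (2 ^ p.2 : ℤ) * |(L.length : ℤ) - 2 * c| = |2 ^ p.2 * ((L.length : ℤ) - 2 * c)| := by
    rw [abs_mul, abs_of_pos (by positivity : (0 : ℤ) < 2 ^ p.2)]
  rw [h2, abs_le]
  zify
  constructor
  · rintro ⟨h3, h4⟩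
    constructor <;> linarith
  · rintro ⟨h3, h4⟩
    constructor <;> linarith

theorem primrecRel_isShortBiasedList : PrimrecRel IsShortBiasedList := by
  have hn : Primrec fun q : (ℕ × ℕ) × List (List Bool) => q.1.1 := Primrec.fst.comp Primrec.fst
  have he : Primrec fun q : (ℕ × ℕ) × List (List Bool) => q.1.2 := Primrec.snd.comp Primrec.fst
  have hlen : Primrec fun q : (ℕ × ℕ) × List (List Bool) => q.2.length :=
    Primrec.list_length.comp Primrec.snd
  have h1 : PrimrecPred fun q : (ℕ × ℕ) × List (List Bool) => q.2.length ≠ 0 :=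
    (Primrec.eq.comp hlen (Primrec.const 0)).not
  have h2 : PrimrecPred fun q : (ℕ × ℕ) × List (List Bool) => ∀ s ∈ q.2, s.length = q.1.1 := by
    have hR : PrimrecRel fun (s : List Bool) (n : ℕ) => s.length = n :=
      Primrec.eq.comp (Primrec.list_length.comp Primrec.fst) Primrec.snd
    exact hR.forall_mem_list.comp Primrec.snd hn
  have h3 : PrimrecPred fun q : (ℕ × ℕ) × List (List Bool) =>
      q.2.length ≤ (q.1.1 + 1) ^ 2 * 4 ^ (q.1.2 + 1) :=
    Primrec.nat_le.comp hlen (Primrec.nat_mul.comp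
      (Primrec.nat_pow.comp (Primrec.succ.comp hn) (Primrec.const 2))
      (Primrec.nat_pow.comp (Primrec.const 4) (Primrec.succ.comp he)))
  have hE : Primrec fun q : List Bool × (ℕ × List (List Bool)) => 2 ^ q.2.1 :=
    Primrec.nat_pow.comp (Primrec.const 2) (Primrec.fst.comp Primrec.snd)
  have hD : Primrec fun q : List Bool × (ℕ × List (List Bool)) => q.2.2.length :=
    Primrec.list_length.comp (Primrec.snd.comp Primrec.snd)
  have hdot : PrimrecRel fun s t : List Bool => dotBool s t = true :=
    Primrec.eq.comp primrec_dotBool (Primrec.const true)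
  have hc : Primrec fun q : List Bool × (ℕ × List (List Bool)) =>
      2 ^ q.2.1 * (2 * (q.2.2.filter fun s => dotBool s q.1 = true).length) :=
    Primrec.nat_mul.comp hE (Primrec.nat_mul.comp (Primrec.const 2) (Primrec.list_length.comp
      (hdot.listFilter.comp (Primrec.snd.comp Primrec.snd) Primrec.fst)))
  have hmem : PrimrecPred fun t : List Bool => ∃ a ∈ t, a = true :=
    PrimrecPred.exists_mem_list (Primrec.eq.comp Primrec.id (Primrec.const true))
  have hR : PrimrecRel fun (t : List Bool) (r : ℕ × List (List Bool)) =>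
      ¬ (∃ a ∈ t, a = true) ∨
      (2 ^ r.1 * (2 * (r.2.filter fun s => dotBool s t = true).length) ≤
          (2 ^ r.1 + 1) * r.2.length ∧
        2 ^ r.1 * r.2.length ≤
          r.2.length + 2 ^ r.1 * (2 * (r.2.filter fun s => dotBool s t = true).length)) :=
    (hmem.comp Primrec.fst).not.or
      ((Primrec.nat_le.comp hc (Primrec.nat_mul.comp (Primrec.succ.comp hE) hD)).and
        (Primrec.nat_le.comp (Primrec.nat_mul.comp hE hD) (Primrec.nat_add.comp hD hc)))
  have h4 := hR.forall_mem_list.comp (primrec_binaryStrings.comp hn) (he.pair Primrec.snd)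
  refine (h1.and (h2.and (h3.and h4))).of_eq fun q => ?_
  simp only [IsShortBiasedList, imp_iff_not_or]

/-- A total primitive recursive relation has a computable choice function. -/
theorem PrimrecRel.exists_computable_choice {α β : Type*} [Primcodable α] [Primcodable β]
    {R : α → β → Prop} (hR : PrimrecRel R) (h : ∀ a, ∃ b, R a b) :
    ∃ f : α → β, Computable f ∧ ∀ a, R a (f a) := by
  classical
  set g : α → ℕ → Option β := fun a n => (Encodable.decode (α := β) n).bind fun b =>
    if R a b then some b else none with hg
  have hgc : Computable₂ g := by
    refine Primrec₂.to_comp ?_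
    refine Primrec.option_bind (Primrec.decode.comp Primrec.snd) ?_
    exact Primrec.ite (hR.comp (Primrec.fst.comp Primrec.fst) Primrec.snd)
      (Primrec.option_some.comp Primrec.snd) (Primrec.const none)
  have hdom : ∀ a, (Nat.rfindOpt (g a)).Dom := fun a => by
    obtain ⟨b, hb⟩ := h a
    exact Nat.rfindOpt_dom.2 ⟨Encodable.encode b, b, by simp [hg, hb]⟩
  refine ⟨fun a => (Nat.rfindOpt (g a)).get (hdom a),
    (Partrec.rfindOpt hgc).of_eq_tot fun a => Part.get_mem _, fun a => ?_⟩
  obtain ⟨n, hn⟩ := Nat.rfindOpt_spec (Part.get_mem (hdom a))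
  change R a ((Nat.rfindOpt (g a)).get (hdom a))
  generalize (Nat.rfindOpt (g a)).get (hdom a) = b at hn ⊢
  simp only [hg, Option.mem_def, Option.bind_eq_some_iff] at hn
  obtain ⟨b', -, hb'⟩ := hn
  split_ifs at hb' with h'
  · cases hb'; exact h'

/-- Small biased lists can be computed. -/
theorem exists_computable_biased_list :
    ∃ L : ℕ × ℕ → List (List Bool), Computable L ∧ ∀ n e, L (n, e) ≠ [] ∧
      (∀ s ∈ L (n, e), s.length = n) ∧ (L (n, e)).length ≤ (n + 1) ^ 2 * 4 ^ (e + 1) ∧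
      ∀ t : List Bool, t.length = n → true ∈ t →
        (2 ^ e : ℤ) * |((L (n, e)).map (chi t)).sum| ≤ (L (n, e)).length := by
  obtain ⟨L, hL, h⟩ := primrecRel_isShortBiasedList.exists_computable_choice fun p =>
    (exists_biased_list p.1 p.2).imp fun L hL => (isShortBiasedList_iff p L).2 hL
  exact ⟨L, hL, fun n e => (isShortBiasedList_iff (n, e) _).1 (h (n, e))⟩

/-! ### Basic facts on complexity: attained minima and counting. -/

/-- The strings of length at most `k`. -/
def stringsUpTo (k : ℕ) : List (List Bool) := (List.range (k + 1)).flatMap binaryStrings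

theorem mem_stringsUpTo {k : ℕ} {p : List Bool} : p ∈ stringsUpTo k ↔ p.length ≤ k := by
  simp [stringsUpTo, mem_binaryStrings]

theorem length_stringsUpTo_lt (k : ℕ) : (stringsUpTo k).length < 2 ^ (k + 1) := by
  induction k with
  | zero => simp [stringsUpTo, binaryStrings]
  | succ k ih =>
    have : stringsUpTo (k + 1) = stringsUpTo k ++ binaryStrings (k + 1) := by
      rw [stringsUpTo, List.range_succ, List.flatMap_append]
      simp [stringsUpTo]
    rw [this, List.length_append, card_binaryStrings, pow_succ 2 (k + 1)]
    omega

theorem primrec_stringsUpTo : Primrec stringsUpTo :=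
  Primrec.list_flatMap (Primrec.list_range.comp Primrec.succ)
    (primrec_binaryStrings.comp Primrec.snd)

theorem kolmogorovComplexity_le_of_mem {U : List Bool →. List Bool} {x p : List Bool}
    (h : x ∈ U p) : kolmogorovComplexity U x ≤ p.length :=
  Nat.sInf_le ⟨p, rfl, h⟩

theorem IsUniversalMachine.exists_program {U : List Bool →. List Bool}
    (hU : IsUniversalMachine U) (x : List Bool) :
    ∃ p, p.length = kolmogorovComplexity U x ∧ x ∈ U p := by
  have hne : {l : ℕ | ∃ p : List Bool, p.length = l ∧ x ∈ U p}.Nonempty := by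
    obtain ⟨t, -, ht, -⟩ := hU.universal (fun _ => Part.some x) (Computable.const x).partrec
    exact ⟨_, t [], rfl, by rw [← ht]; exact Part.mem_some x⟩
  exact Nat.sInf_mem hne

theorem IsUniversalMachine.kolmogorovComplexity_le_iff {U : List Bool →. List Bool}
    (hU : IsUniversalMachine U) {x : List Bool} {k : ℕ} :
    kolmogorovComplexity U x ≤ k ↔ ∃ p ∈ stringsUpTo k, x ∈ U p := by
  simp only [mem_stringsUpTo]
  constructor
  · intro h
    obtain ⟨p, hp, hx⟩ := hU.exists_program x
    exact ⟨p, hp.trans_le h, hx⟩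
  · rintro ⟨p, hp, hx⟩
    exact (kolmogorovComplexity_le_of_mem hx).trans hp

/-- There are fewer than `2 ^ (k + 1)` strings of complexity at most `k`. -/
theorem IsUniversalMachine.card_le_complexity_lt {U : List Bool →. List Bool}
    (hU : IsUniversalMachine U) {k : ℕ} (B : Finset (List Bool))
    (hB : ∀ y ∈ B, kolmogorovComplexity U y ≤ k) : B.card < 2 ^ (k + 1) := by
  refine lt_of_le_of_lt ?_ (length_stringsUpTo_lt k)
  choose! p hp hx using fun y hy => hU.kolmogorovComplexity_le_iff.1 (hB y hy)
  calc B.card ≤ (stringsUpTo k).toFinset.card := by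
        refine Finset.card_le_card_of_injOn p (fun y hy => ?_) fun y hy z hz h => ?_
        · simpa using hp y hy
        · exact Part.mem_unique (hx y hy) (h ▸ hx z hz)
    _ ≤ _ := List.toFinset_card_le _

/-! ### Describing a string by its index in an enumeration. -/

/-- The index `i`, which codes a string `x` and a time `t`, is a hit if `t` is the first stage
at which `x` is seen to satisfy `W`. -/
def isFirstHit {α : Type*} (W : α → List Bool → ℕ → Bool) (a : α) (i : ℕ) : Bool :=
  ((Encodable.decode₂ (List Bool) i.unpair.1).map fun x =>
    -- The guard is needed at time 0, where the truncated predecessor is 0 again.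
    W a x i.unpair.2 && !(decide (0 < i.unpair.2) && W a x (i.unpair.2 - 1))).getD false

section FirstHit

variable {α : Type*} {W : α → List Bool → ℕ → Bool}

theorem isFirstHit_iff {a : α} {i : ℕ} : isFirstHit W a i = true ↔
    ∃ x : List Bool, ∃ t : ℕ, i = Nat.pair (Encodable.encode x) t ∧ W a x t = true ∧
      (0 < t → W a x (t - 1) = false) := by
  constructor
  · intro h
    unfold isFirstHit at h
    rcases hd : Encodable.decode₂ (List Bool) i.unpair.1 with _ | x
    · simp [hd] at h
    · rw [Encodable.decode₂_eq_some] at hd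
      refine ⟨x, i.unpair.2, ?_, ?_⟩
      · rw [hd, Nat.pair_unpair]
      · rw [← hd, Encodable.decode₂_encode] at h
        simp only [Option.map_some, Option.getD_some, Bool.and_eq_true, Bool.not_eq_true',
          Bool.and_eq_false_iff, decide_eq_false_iff_not] at h
        exact ⟨h.1, fun h0 => h.2.resolve_left (not_not.2 h0)⟩
  · rintro ⟨x, t, rfl, h1, h2⟩
    simp only [isFirstHit, Nat.unpair_pair, Encodable.decode₂_encode, Option.map_some,
      Option.getD_some, h1, Bool.true_and]
    by_cases h : 0 < t
    · simp [h2 h]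
    · simp [h]

theorem exists_isFirstHit {a : α} {x : List Bool} (h : ∃ t, W a x t = true) :
    ∃ t, isFirstHit W a (Nat.pair (Encodable.encode x) t) = true := by
  classical
  refine ⟨Nat.find h, isFirstHit_iff.2 ⟨x, _, rfl, Nat.find_spec h, fun h0 => ?_⟩⟩
  have := Nat.find_min h (Nat.sub_lt h0 one_pos)
  simpa using this

/-- By monotonicity in time every string has at most one first hit, so hits inject into the strings
eventually accepted. -/
theorem count_isFirstHit_le (hmono : ∀ a x t t', t ≤ t' → W a x t = true → W a x t' = true) {a : α}
    {N : ℕ} (hcard : ∀ T : Finset (List Bool), (∀ x ∈ T, ∃ t, W a x t = true) → T.card ≤ N)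
    (i : ℕ) : Nat.count (fun k => isFirstHit W a k = true) i ≤ N := by
  rw [Nat.count_eq_card_filter_range]
  set H := (Finset.range i).filter fun k => isFirstHit W a k = true
  have hH : ∀ k ∈ H, ∃ x : List Bool, ∃ t : ℕ, k = Nat.pair (Encodable.encode x) t ∧
      W a x t = true ∧ (0 < t → W a x (t - 1) = false) := fun k hk =>
    isFirstHit_iff.1 (Finset.mem_filter.1 hk).2
  choose! x t hk hW hmin using hH
  have hinj : Set.InjOn x H := by
    intro k hkH k' hkH' hxx
    have key : ∀ k ∈ H, ∀ k' ∈ H, x k = x k' → ¬ t k < t k' := by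
      intro k hkH k' hkH' hxx hlt
      have h1 := hmin k' hkH' (by omega)
      have h2 := hmono a _ _ (t k' - 1) (by omega) (hW k hkH)
      rw [hxx, h1] at h2
      exact Bool.false_ne_true h2
    have ht : t k = t k' := by
      have h1 := key k hkH k' hkH' hxx
      have h2 := key k' hkH' k hkH hxx.symm
      omega
    rw [hk k hkH, hk k' hkH', hxx, ht]
  rw [← Finset.card_image_of_injOn hinj]
  refine hcard _ fun y hy => ?_
  obtain ⟨k, hkH, rfl⟩ := Finset.mem_image.1 hy
  exact ⟨t k, hW k hkH⟩

theorem computable_isFirstHit [Primcodable α]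
    (hW : Computable fun q : (α × List Bool) × ℕ => W q.1.1 q.1.2 q.2) :
    Computable₂ (isFirstHit W) := by
  have hx : Computable fun q : α × ℕ => Encodable.decode₂ (List Bool) q.2.unpair.1 :=
    Primrec.to_comp (Primrec.decode₂.comp (Primrec.fst.comp (Primrec.unpair.comp Primrec.snd)))
  have ht : Computable fun q : (α × ℕ) × List Bool => q.1.2.unpair.2 :=
    Primrec.to_comp (Primrec.snd.comp (Primrec.unpair.comp (Primrec.snd.comp Primrec.fst)))
  have hax : Computable fun q : (α × ℕ) × List Bool => (q.1.1, q.2) :=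
    (Computable.fst.comp Computable.fst).pair Computable.snd
  have h0 : Computable fun t : ℕ => decide (0 < t) :=
    Primrec.to_comp (Primrec.nat_lt.comp (Primrec.const 0) Primrec.id).decide
  have h1 : Computable fun q : (α × ℕ) × List Bool => W q.1.1 q.2 q.1.2.unpair.2 := by
    refine (hW.comp (hax.pair ht)).of_eq fun q => ?_
    dsimp only
  have h2 : Computable fun q : (α × ℕ) × List Bool => W q.1.1 q.2 (q.1.2.unpair.2 - 1) := by
    refine (hW.comp (hax.pair (Computable.pred.comp ht))).of_eq fun q => ?_
    dsimp only [Nat.pred_eq_sub_one]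
  have h3 : Computable fun q : (α × ℕ) × List Bool => decide (0 < q.1.2.unpair.2) := h0.comp ht
  have h4 : Computable fun q : (α × ℕ) × List Bool =>
      (decide (0 < q.1.2.unpair.2) && W q.1.1 q.2 (q.1.2.unpair.2 - 1)) :=
    Primrec.and.to_comp.comp h3 h2
  have hbody : Computable₂ fun (q : α × ℕ) (x : List Bool) => W q.1 x q.2.unpair.2 &&
      !(decide (0 < q.2.unpair.2) && W q.1 x (q.2.unpair.2 - 1)) :=
    Primrec.and.to_comp.comp h1 (Primrec.not.to_comp.comp h4)
  exact Computable.option_getD (Computable.option_map hx hbody) (Computable.const false)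

end FirstHit

/-- Counting with a computable predicate is computable. -/
theorem computable_count {α : Type*} [Primcodable α] {f : α → ℕ → Bool} (hf : Computable₂ f) :
    Computable₂ fun a i => Nat.count (fun k => f a k = true) i := by
  refine Computable.of_eq (f := fun q : α × ℕ => Nat.rec (motive := fun _ => ℕ) 0
    (fun k c => cond (f q.1 k) (c + 1) c) q.2) ?_ fun q => ?_
  · refine Computable.nat_rec (h := fun q (r : ℕ × ℕ) => cond (f q.1 r.1) (r.2 + 1) r.2)
      Computable.snd (Computable.const 0) ?_
    have hc : Computable fun q : (α × ℕ) × ℕ × ℕ => q.2.2 :=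
      Computable.snd.comp Computable.snd
    exact Computable.cond (hf.comp (Computable.fst.comp Computable.fst)
      (Computable.fst.comp Computable.snd)) (Computable.succ.comp hc) hc
  · obtain ⟨a, i⟩ := q
    induction i with
    | zero => rfl
    | succ i ih =>
      simp only [Nat.count_succ] at ih ⊢
      rw [ih]
      cases f a i <;> rfl

/-- If the sets `W (j, l)` are uniformly recursively enumerable and `W (j, l)` has at most `2 ^ l`
elements, then every element of `W (j, l)` has complexity at most `l + j + O(1)`. -/
theorem IsUniversalMachine.exists_complexity_le {U : List Bool →. List Bool}
    (hU : IsUniversalMachine U) {W : ℕ × ℕ → List Bool → ℕ → Bool}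
    (hW : Computable fun q : ((ℕ × ℕ) × List Bool) × ℕ => W q.1.1 q.1.2 q.2)
    (hmono : ∀ a x t t', t ≤ t' → W a x t = true → W a x t' = true)
    (hcard : ∀ j l, ∀ T : Finset (List Bool), (∀ x ∈ T, ∃ t, W (j, l) x t = true) →
      T.card ≤ 2 ^ l) :
    ∃ c, ∀ j l x, (∃ t, W (j, l) x t = true) → kolmogorovComplexity U x ≤ l + j + c := by
  -- A program has the form `1 ^ j 0 q`: the parameter `l` is the length of `q`, and the position of
  -- `q` among the strings of that length is the index of the hit.
  set par : List Bool → ℕ × ℕ := fun p =>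
    ((p.takeWhile id).length, (p.dropWhile id).tail.length) with hpar
  have hparc : Computable par := Primrec.to_comp
    ((Primrec.list_length.comp (Primrec.list_takeWhile Primrec.id)).pair
      (Primrec.list_length.comp (Primrec.list_tail.comp (Primrec.list_dropWhile Primrec.id))))
  set val : List Bool → ℕ := fun p =>
    (binaryStrings (par p).2).idxOf (p.dropWhile id).tail with hval
  have hvalc : Computable val := by
    refine Primrec.to_comp (Primrec.of_eq
      (Primrec.list_idxOf.comp (Primrec.list_tail.comp (Primrec.list_dropWhile Primrec.id))
        (primrec_binaryStrings.comp (Primrec.list_length.comp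
          (Primrec.list_tail.comp (Primrec.list_dropWhile Primrec.id))))) fun p => ?_)
    simp only [hval, hpar]
    congr
    exact lawful_beq_subsingleton _ _
  set g : List Bool → ℕ → Option (List Bool) := fun p i =>
    cond (isFirstHit W (par p) i &&
        decide (Nat.count (fun k => isFirstHit W (par p) k = true) i = val p))
      (Encodable.decode₂ (List Bool) i.unpair.1) none with hg
  have hgc : Computable₂ g := by
    have hh := computable_isFirstHit hW
    have hp : Computable fun q : List Bool × ℕ => par q.1 := hparc.comp Computable.fst
    refine Computable.cond (Primrec.and.to_comp.comp (hh.comp hp Computable.snd) ?_)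
      (Primrec.to_comp (Primrec.decode₂.comp
        (Primrec.fst.comp (Primrec.unpair.comp Primrec.snd)))) (Computable.const none)
    exact (Primrec.eq.decide.to_comp).comp ((computable_count hh).comp hp Computable.snd)
      (hvalc.comp Computable.fst)
  obtain ⟨t, -, ht, c, hc⟩ := hU.universal _ (Partrec.rfindOpt hgc)
  -- The extra 1 pays for the separating zero.
  refine ⟨c + 1, fun j l x hx => ?_⟩
  obtain ⟨s, hs⟩ := exists_isFirstHit hx
  set i := Nat.pair (Encodable.encode x) s with hi
  set v := Nat.count (fun k => isFirstHit W (j, l) k = true) i with hv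
  have hvlt : v < 2 ^ l := by
    -- Counting up to `i + 1` includes the hit `i` itself, which makes the bound on `v` strict.
    have h1 := count_isFirstHit_le hmono (hcard j l) (i + 1)
    rw [Nat.count_succ, if_pos hs] at h1
    exact h1
  rw [← card_binaryStrings l] at hvlt
  set q := (binaryStrings l)[v] with hq
  have hql : q.length = l := mem_binaryStrings.1 (List.getElem_mem hvlt)
  set p := List.replicate j true ++ false :: q with hp
  have htw : p.takeWhile id = List.replicate j true := by
    rw [hp, List.takeWhile_append_of_pos (by simp)]
    simp
  have hdw : p.dropWhile id = false :: q := by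
    rw [hp, List.dropWhile_append_of_pos (by simp)]
    simp
  have hparp : par p = (j, l) := by simp [hpar, htw, hdw, hql]
  have hvalp : val p = v := by
    simp only [hval, hparp, hdw, List.tail_cons]
    exact (nodup_binaryStrings l).idxOf_getElem v hvlt
  have hgi : g p i = some x := by
    simp only [hg, hparp, hvalp, hs, ← hv, decide_true, Bool.and_true, cond_true]
    rw [hi, Nat.unpair_pair, Encodable.decode₂_encode]
  have hxM : x ∈ Nat.rfindOpt (g p) := by
    have hdom : (Nat.rfindOpt (g p)).Dom := Nat.rfindOpt_dom.2 ⟨i, x, hgi⟩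
    obtain ⟨i', hi'⟩ := Nat.rfindOpt_spec (Part.get_mem hdom)
    -- Two hits with the same number of earlier hits coincide, so the search can only stop at `i`.
    have hii : i' = i := by
      have hc' : (isFirstHit W (par p) i' &&
          decide (Nat.count (fun k => isFirstHit W (par p) k = true) i' = val p)) = true := by
        by_contra h
        rw [Bool.not_eq_true] at h
        simp [hg, h] at hi'
      rw [hparp, hvalp, Bool.and_eq_true, decide_eq_true_eq, hv] at hc'
      exact Nat.count_injective hc'.1 hs hc'.2
    rw [hii, hgi, Option.mem_def, Option.some_inj] at hi'
    rw [hi']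
    exact Part.get_mem hdom
  rw [ht] at hxM
  refine (kolmogorovComplexity_le_of_mem hxM).trans ((hc p).trans ?_)
  rw [hp, List.length_append, List.length_replicate, List.length_cons, hql]
  omega

/-- The statement `C(y) ≤ k` is the limit of an increasing sequence of primitive recursive
relations. -/
theorem IsUniversalMachine.exists_approximation {U : List Bool →. List Bool}
    (hU : IsUniversalMachine U) :
    ∃ S : List Bool → ℕ × ℕ → Prop, PrimrecRel S ∧
      (∀ y k t t', t ≤ t' → S y (k, t) → S y (k, t')) ∧
      ∀ y k, kolmogorovComplexity U y ≤ k ↔ ∃ t, S y (k, t) := by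
  obtain ⟨c, hc⟩ := Nat.Partrec.Code.exists_code.1 hU.partrec
  have hmem : ∀ p y : List Bool, y ∈ U p ↔ ∃ t, Encodable.encode y ∈
      Nat.Partrec.Code.evaln t c (Encodable.encode p) := by
    intro p y
    rw [← Nat.Partrec.Code.evaln_complete, hc]
    simp
  refine ⟨fun y r => ∃ p ∈ stringsUpTo r.1, Nat.Partrec.Code.evaln r.2 c (Encodable.encode p) =
    some (Encodable.encode y), ?_, ?_, ?_⟩
  · have hR : PrimrecRel fun (p : List Bool) (q : List Bool × (ℕ × ℕ)) =>
        Nat.Partrec.Code.evaln q.2.2 c (Encodable.encode p) = some (Encodable.encode q.1) :=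
      Primrec.eq.comp
        (Nat.Partrec.Code.primrec_evaln.comp
          (((Primrec.snd.comp (Primrec.snd.comp Primrec.snd)).pair (Primrec.const c)).pair
            (Primrec.encode.comp Primrec.fst)))
        (Primrec.option_some.comp (Primrec.encode.comp (Primrec.fst.comp Primrec.snd)))
    exact hR.exists_mem_list.comp
      (primrec_stringsUpTo.comp (Primrec.fst.comp Primrec.snd)) Primrec.id
  · rintro y k t t' htt ⟨p, hp, h⟩
    exact ⟨p, hp, Nat.Partrec.Code.evaln_mono htt h⟩
  · intro y k
    rw [hU.kolmogorovComplexity_le_iff]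
    simp only [hmem, Option.mem_def]
    constructor
    · rintro ⟨p, hp, t, h⟩
      exact ⟨t, p, hp, h⟩
    · rintro ⟨t, p, hp, h⟩
      exact ⟨p, hp, t, h⟩

/-! ### Exceptional strings are few, and hence simple. -/

open Classical in
/-- The string `x` is exceptional for the family of lists `L` if a fraction at least `2 ^ (-j)` of
its translates by the elements of a list have complexity at most `k`. -/
def IsExceptional (U : List Bool →. List Bool) (L : ℕ × ℕ → List (List Bool)) (j k : ℕ)
    (x : List Bool) : Prop :=
  -- With `E = 2 ^ (2 * j + 1)`, this length condition says `E ^ 2 * 2 ^ (k + 1) ≤ 2 ^ n`, the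
  -- smallness needed in `card_many_translates_le`.
  k + 4 * j + 3 ≤ x.length ∧ (L (x.length, 2 * j + 1)).length ≤
    2 ^ j * (L (x.length, 2 * j + 1)).countP fun s =>
      decide (kolmogorovComplexity U (xorString x s) ≤ k)

section Exceptional

variable {U : List Bool →. List Bool} {L : ℕ × ℕ → List (List Bool)}

/-- The second moment bound reads `E ^ 2 * |T| ≤ 2 * 4 ^ j * |B|`. The choice `E = 2 * 4 ^ j` turns
it into a gain of a factor `E`. -/
theorem IsUniversalMachine.card_exceptional_of_length_le (hU : IsUniversalMachine U)
    {n j k : ℕ} (hne : L (n, 2 * j + 1) ≠ []) (hlen : ∀ s ∈ L (n, 2 * j + 1), s.length = n)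
    (hbias : ∀ t : List Bool, t.length = n → true ∈ t →
      (2 ^ (2 * j + 1) : ℤ) * |((L (n, 2 * j + 1)).map (chi t)).sum| ≤
        (L (n, 2 * j + 1)).length)
    {B : Finset (List Bool)}
    (hB : ∀ y, y ∈ B ↔ y.length = n ∧ kolmogorovComplexity U y ≤ k)
    {T : Finset (List Bool)} (hT : ∀ x ∈ T, x.length = n ∧ IsExceptional U L j k x) :
    2 ^ (2 * j + 1) * T.card ≤ B.card := by
  classical
  rcases T.eq_empty_or_nonempty with rfl | ⟨x₀, hx₀⟩
  · simp
  have hkn : k + 4 * j + 3 ≤ n := (hT x₀ hx₀).1 ▸ (hT x₀ hx₀).2.1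
  have hb := (hU.card_le_complexity_lt B fun y hy => ((hB y).1 hy).2).le
  have h := card_many_translates_le (j := j) hlen hne (E := 2 ^ (2 * j + 1))
    (by push_cast; exact hbias) B (fun y hy => ((hB y).1 hy).1) ?_ T ?_
  · have h4 : (2 ^ (2 * j + 1)) ^ 2 * T.card = 2 ^ (2 * j + 1) * (2 ^ (2 * j + 1) * T.card) := by
      ring
    have h5 : 2 * 4 ^ j * B.card = 2 ^ (2 * j + 1) * B.card := by
      rw [pow_succ, pow_mul]; ring
    rw [h4, h5] at h
    exact Nat.le_of_mul_le_mul_left h (by positivity)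
  · calc _ ≤ (2 ^ (2 * j + 1)) ^ 2 * 2 ^ (k + 1) := Nat.mul_le_mul_left _ hb
      _ = 2 ^ (k + 4 * j + 3) := by rw [← pow_mul, ← pow_add]; congr 1; ring
      _ ≤ 2 ^ n := Nat.pow_le_pow_right (by norm_num) hkn
  · intro x hx
    obtain ⟨rfl, -, h2⟩ := hT x hx
    refine ⟨rfl, ?_⟩
    have h3 : ((L (x.length, 2 * j + 1)).map fun s =>
        if xorString x s ∈ B then (1 : ℤ) else 0).sum =
        (L (x.length, 2 * j + 1)).countP fun s =>
          decide (kolmogorovComplexity U (xorString x s) ≤ k) := by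
      have h4 : ∀ M : List (List Bool), (∀ s ∈ M, s.length = x.length) →
          (M.map fun s => if xorString x s ∈ B then (1 : ℤ) else 0).sum =
          M.countP fun s => decide (kolmogorovComplexity U (xorString x s) ≤ k) := by
        intro M hM
        induction M with
        | nil => simp
        | cons s M ih =>
          have h6 := length_xorString (s := x) rfl (hM s (by simp))
          rw [List.map_cons, List.sum_cons, ih fun u hu => hM u (by simp [hu]),
            List.countP_cons]
          simp only [hB, h6, true_and, decide_eq_true_eq]
          push_cast
          ring
      exact h4 _ hlen
    rw [h3]
    exact_mod_cast h2

/-- The sets of simple strings of different lengths are disjoint and share the single budget `2 ^ (k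
+ 1)`, so the bounds for each length add up without loss. -/
theorem IsUniversalMachine.card_exceptional_lt (hU : IsUniversalMachine U)
    (hL : ∀ n e, L (n, e) ≠ [] ∧ (∀ s ∈ L (n, e), s.length = n) ∧
      ∀ t : List Bool, t.length = n → true ∈ t →
        (2 ^ e : ℤ) * |((L (n, e)).map (chi t)).sum| ≤ (L (n, e)).length)
    {j k : ℕ} {T : Finset (List Bool)} (hT : ∀ x ∈ T, IsExceptional U L j k x) :
    2 ^ (2 * j + 1) * T.card < 2 ^ (k + 1) := by
  classical
  set B : ℕ → Finset (List Bool) := fun n =>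
    (binaryStrings n).toFinset.filter fun y => kolmogorovComplexity U y ≤ k with hBdef
  have hB : ∀ n y, y ∈ B n ↔ y.length = n ∧ kolmogorovComplexity U y ≤ k := by
    intro n y
    simp [hBdef, mem_binaryStrings]
  calc 2 ^ (2 * j + 1) * T.card
      = ∑ n ∈ T.image List.length,
          2 ^ (2 * j + 1) * (T.filter fun x => x.length = n).card := by
        rw [Finset.card_eq_sum_card_image List.length T, Finset.mul_sum]
    _ ≤ ∑ n ∈ T.image List.length, (B n).card := by
        refine Finset.sum_le_sum fun n _ => ?_
        obtain ⟨h1, h2, h3⟩ := hL n (2 * j + 1)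
        refine hU.card_exceptional_of_length_le h1 h2 h3 (hB n) fun x hx => ?_
        rw [Finset.mem_filter] at hx
        exact ⟨hx.2, hT x hx.1⟩
    _ = ((T.image List.length).biUnion B).card := by
        rw [Finset.card_biUnion]
        intro m _ n _ hmn
        rw [Function.onFun, Finset.disjoint_left]
        intro y hy hy'
        exact hmn (((hB m y).1 hy).1.symm.trans ((hB n y).1 hy').1)
    _ < 2 ^ (k + 1) := by
        refine hU.card_le_complexity_lt _ fun y hy => ?_
        obtain ⟨n, -, hy⟩ := Finset.mem_biUnion.1 hy
        exact ((hB n y).1 hy).2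

/-- Exceptional strings have programs that are shorter by almost `j` bits than `k`. -/
theorem IsUniversalMachine.exists_complexity_exceptional_le (hU : IsUniversalMachine U)
    (hLc : Computable L)
    (hL : ∀ n e, L (n, e) ≠ [] ∧ (∀ s ∈ L (n, e), s.length = n) ∧
      ∀ t : List Bool, t.length = n → true ∈ t →
        (2 ^ e : ℤ) * |((L (n, e)).map (chi t)).sum| ≤ (L (n, e)).length) :
    ∃ c, ∀ j l x, IsExceptional U L j (l + 2 * j) x → kolmogorovComplexity U x ≤ l + j + c := by
  classical
  obtain ⟨S, hS, hSmono, hSU⟩ := hU.exists_approximation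
  -- Exceptionality as seen at stage `t`. The list is an argument because `L` is only known to be
  -- computable, while the rest of the test is primitive recursive.
  set V : (ℕ × ℕ) × List Bool × ℕ × List (List Bool) → Prop := fun q =>
    q.1.2 + 2 * q.1.1 + 4 * q.1.1 + 3 ≤ q.2.1.length ∧
    q.2.2.2.length ≤ 2 ^ q.1.1 * (q.2.2.2.filter fun s =>
      S (xorString q.2.1 s) (q.1.2 + 2 * q.1.1, q.2.2.1)).length with hV
  have hVp : PrimrecPred V := by
    have hj : Primrec fun q : (ℕ × ℕ) × List Bool × ℕ × List (List Bool) => q.1.1 :=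
      Primrec.fst.comp Primrec.fst
    have hl : Primrec fun q : (ℕ × ℕ) × List Bool × ℕ × List (List Bool) => q.1.2 :=
      Primrec.snd.comp Primrec.fst
    have hx : Primrec fun q : (ℕ × ℕ) × List Bool × ℕ × List (List Bool) => q.2.1 :=
      Primrec.fst.comp Primrec.snd
    have ht : Primrec fun q : (ℕ × ℕ) × List Bool × ℕ × List (List Bool) => q.2.2.1 :=
      Primrec.fst.comp (Primrec.snd.comp Primrec.snd)
    have hM : Primrec fun q : (ℕ × ℕ) × List Bool × ℕ × List (List Bool) => q.2.2.2 :=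
      Primrec.snd.comp (Primrec.snd.comp Primrec.snd)
    have hk : Primrec fun q : (ℕ × ℕ) × List Bool × ℕ × List (List Bool) =>
        q.1.2 + 2 * q.1.1 :=
      Primrec.nat_add.comp hl (Primrec.nat_mul.comp (Primrec.const 2) hj)
    have hR : PrimrecRel fun (s : List Bool) (r : List Bool × (ℕ × ℕ)) =>
        S (xorString r.1 s) r.2 :=
      hS.comp (primrec_xorString.comp (Primrec.fst.comp Primrec.snd) Primrec.fst)
        (Primrec.snd.comp Primrec.snd)
    refine PrimrecPred.and ?_ ?_
    · exact Primrec.nat_le.comp (Primrec.nat_add.comp (Primrec.nat_add.comp hk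
        (Primrec.nat_mul.comp (Primrec.const 4) hj)) (Primrec.const 3))
        (Primrec.list_length.comp hx)
    · exact Primrec.nat_le.comp (Primrec.list_length.comp hM) (Primrec.nat_mul.comp
        (Primrec.nat_pow.comp (Primrec.const 2) hj)
        (Primrec.list_length.comp (hR.listFilter.comp hM (hx.pair (hk.pair ht)))))
  set W : ℕ × ℕ → List Bool → ℕ → Bool := fun a x t =>
    decide (V (a, x, t, L (x.length, 2 * a.1 + 1))) with hW
  have hWc : Computable fun q : ((ℕ × ℕ) × List Bool) × ℕ => W q.1.1 q.1.2 q.2 := by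
    have ha : Computable fun q : ((ℕ × ℕ) × List Bool) × ℕ => q.1.1 :=
      Computable.fst.comp Computable.fst
    have hx : Computable fun q : ((ℕ × ℕ) × List Bool) × ℕ => q.1.2 :=
      Computable.snd.comp Computable.fst
    have he : Computable fun q : ((ℕ × ℕ) × List Bool) × ℕ => 2 * q.1.1.1 + 1 :=
      Primrec.nat_double_succ.to_comp.comp (Computable.fst.comp ha)
    exact hVp.decide.to_comp.comp (ha.pair (hx.pair (Computable.snd.pair
      (hLc.comp ((Computable.list_length.comp hx).pair he)))))
  have hmono : ∀ a x t t', t ≤ t' → W a x t = true → W a x t' = true := by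
    intro a x t t' htt h
    simp only [hW, hV, decide_eq_true_eq] at h ⊢
    refine ⟨h.1, h.2.trans (Nat.mul_le_mul_left _ ?_)⟩
    refine (List.monotone_filter_right _ fun s hs => ?_).length_le
    simp only [decide_eq_true_eq] at hs ⊢
    exact hSmono _ _ _ _ htt hs
  have hexc : ∀ j l x, (∃ t, W (j, l) x t = true) → IsExceptional U L j (l + 2 * j) x := by
    rintro j l x ⟨t, h⟩
    simp only [hW, hV, decide_eq_true_eq] at h
    refine ⟨h.1, h.2.trans (Nat.mul_le_mul_left _ ?_)⟩
    rw [List.countP_eq_length_filter]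
    refine (List.monotone_filter_right _ fun s hs => ?_).length_le
    simp only [decide_eq_true_eq] at hs ⊢
    exact (hSU _ _).2 ⟨t, hs⟩
  obtain ⟨c, hc⟩ := hU.exists_complexity_le hWc hmono fun j l T hT => by
    have h := hU.card_exceptional_lt hL fun x hx => hexc j l x (hT x hx)
    rw [show l + 2 * j + 1 = 2 * j + 1 + l by ring, pow_add _ _ l] at h
    exact (Nat.lt_of_mul_lt_mul_left h).le
  refine ⟨c, fun j l x hx => hc j l x ?_⟩
  -- One stage serves all the simple translates, as there are finitely many.
  obtain ⟨t, ht⟩ : ∃ t, ∀ s ∈ L (x.length, 2 * j + 1),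
      kolmogorovComplexity U (xorString x s) ≤ l + 2 * j →
        S (xorString x s) (l + 2 * j, t) := by
    generalize L (x.length, 2 * j + 1) = M
    induction M with
    | nil => exact ⟨0, by simp⟩
    | cons s M ih =>
      obtain ⟨t, ht⟩ := ih
      by_cases h : kolmogorovComplexity U (xorString x s) ≤ l + 2 * j
      · obtain ⟨t', ht'⟩ := (hSU _ _).1 h
        refine ⟨max t t', fun u hu hu' => ?_⟩
        rcases List.mem_cons.1 hu with rfl | hu
        · exact hSmono _ _ _ _ (le_max_right _ _) ht'
        · exact hSmono _ _ _ _ (le_max_left _ _) (ht u hu hu')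
      · refine ⟨t, fun u hu hu' => ?_⟩
        rcases List.mem_cons.1 hu with rfl | hu
        · exact absurd hu' h
        · exact ht u hu hu'
  refine ⟨t, ?_⟩
  simp only [hW, hV, decide_eq_true_eq]
  refine ⟨hx.1, hx.2.trans (Nat.mul_le_mul_left _ ?_)⟩
  rw [← List.countP_eq_length_filter]
  refine List.countP_mono_left fun s hs h => ?_
  simp only [decide_eq_true_eq] at h ⊢
  exact ht s hs h

end Exceptional

/-! ### Choice of parameters and the main theorem. -/

/-- A computable function that rounds up to powers of 2. -/
theorem exists_computable_log :
    ∃ lg : ℕ → ℕ, Computable lg ∧ ∀ t, t < 2 ^ lg t ∧ 2 ^ lg t ≤ 2 * t + 1 := by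
  have hR : PrimrecRel fun t i : ℕ => t < 2 ^ i ∧ 2 ^ i ≤ 2 * t + 1 :=
    (Primrec.nat_lt.comp Primrec.fst (Primrec.nat_pow.comp (Primrec.const 2) Primrec.snd)).and
      (Primrec.nat_le.comp (Primrec.nat_pow.comp (Primrec.const 2) Primrec.snd)
        (Primrec.nat_double_succ.comp Primrec.fst))
  refine hR.exists_computable_choice fun t => ?_
  rcases Nat.eq_zero_or_pos t with rfl | ht
  · exact ⟨0, by norm_num⟩
  · refine ⟨Nat.log 2 t + 1, Nat.lt_pow_succ_log_self (by norm_num) t, ?_⟩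
    have := Nat.pow_log_le_self 2 ht.ne'
    rw [pow_succ]
    omega

theorem theorem1 (U : List Bool →. List Bool) (hU : IsUniversalMachine U) :
    ∃ f : List Bool → ℚ → List (List Bool), ComputableListFunction f ∧
      -- the list is nonempty and consists of strings of length `|x|`
      (∀ (x : List Bool) (δ : ℚ), 0 < δ →
        f x δ ≠ [] ∧ ∀ y ∈ f x δ, y.length = x.length) ∧
      -- the list has `O(|x|^2) * poly(1/δ)` elements
      (∃ P : Polynomial ℚ, ∀ (x : List Bool) (δ : ℚ), 0 < δ → 1 ≤ x.length →
        ((f x δ).length : ℚ) ≤ (x.length : ℚ) ^ 2 * P.eval (1 / δ)) ∧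
      -- if `C(x) < |x| - log log |x| - c(δ)` then a `1 - δ` fraction of the list is more complex
      (∀ δ : ℚ, 0 < δ → ∃ c : ℕ, ∀ x : List Bool, 2 ≤ x.length →
        (kolmogorovComplexity U x : ℝ) <
          (x.length : ℝ) - Real.logb 2 (Real.logb 2 (x.length : ℝ)) - (c : ℝ) →
        (1 - δ) * ((f x δ).length : ℚ) ≤ (countMoreComplex U x (f x δ) : ℚ)) := by
  obtain ⟨L, hLc, hLspec⟩ := exists_computable_biased_list
  have hL : ∀ n e, L (n, e) ≠ [] ∧ (∀ s ∈ L (n, e), s.length = n) ∧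
      ∀ t : List Bool, t.length = n → true ∈ t →
        (2 ^ e : ℤ) * |((L (n, e)).map (chi t)).sum| ≤ (L (n, e)).length := fun n e =>
    ⟨(hLspec n e).1, (hLspec n e).2.1, (hLspec n e).2.2.2⟩
  obtain ⟨c, hc⟩ := hU.exists_complexity_exceptional_le hLc hL
  obtain ⟨lg, hlgc, hlg⟩ := exists_computable_log
  have hlow : ∀ δ : ℚ, 0 < δ → 1 ≤ δ * 2 ^ (lg ⌊1 / δ⌋₊) := by
    intro δ hδ
    have h1 : 1 / δ < ⌊1 / δ⌋₊ + 1 := Nat.lt_floor_add_one _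
    have h2 : ((⌊1 / δ⌋₊ : ℚ) + 1) ≤ 2 ^ (lg ⌊1 / δ⌋₊) := by exact_mod_cast (hlg ⌊1 / δ⌋₊).1
    have h3 := h1.le.trans h2
    rwa [div_le_iff₀ hδ, mul_comm] at h3
  have hupp : ∀ δ : ℚ, 0 < δ → (2 : ℚ) ^ (lg ⌊1 / δ⌋₊) ≤ 2 * (1 / δ) + 1 := by
    intro δ hδ
    have h1 : (⌊1 / δ⌋₊ : ℚ) ≤ 1 / δ := Nat.floor_le (by positivity)
    have h2 : (2 : ℚ) ^ (lg ⌊1 / δ⌋₊) ≤ 2 * ⌊1 / δ⌋₊ + 1 := by exact_mod_cast (hlg ⌊1 / δ⌋₊).2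
    linarith
  -- The first summand gives `2 ^ (-j) ≤ δ`, the second `j > c`. For `δ` given as a fraction, the
  -- floor is a division of natural numbers.
  set j : ℚ → ℕ := fun δ => lg ⌊1 / δ⌋₊ + (c + 1) with hj
  refine ⟨fun x δ => (L (x.length, 2 * j δ + 1)).map (xorString x), ?_, ?_, ?_, ?_⟩
  · have hjc : Computable fun z : List Bool × ℕ × ℕ =>
        2 * (lg (z.2.2 / z.2.1) + (c + 1)) + 1 :=
      Primrec.nat_double_succ.to_comp.comp (Primrec.nat_add.to_comp.comp
        (hlgc.comp (Primrec.nat_div.to_comp.comp (Computable.snd.comp Computable.snd)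
          (Computable.fst.comp Computable.snd))) (Computable.const (c + 1)))
    have hmap : Primrec₂ fun (x : List Bool) (M : List (List Bool)) => M.map (xorString x) :=
      Primrec.list_map Primrec.snd
        (primrec_xorString.comp (Primrec.fst.comp Primrec.fst) Primrec.snd)
    refine (hmap.to_comp.comp Computable.fst
      (hLc.comp ((Computable.list_length.comp Computable.fst).pair hjc))).of_eq fun z => ?_
    simp only [hj, one_div_div, Nat.floor_div_eq_div]
  · intro x δ _
    obtain ⟨h1, h2, -⟩ := hL x.length (2 * j δ + 1)
    refine ⟨by simpa using h1, fun y hy => ?_⟩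
    obtain ⟨s, hs, rfl⟩ := List.mem_map.1 hy
    exact length_xorString rfl (h2 s hs)
  -- Here `4 ^ (2 * j + 2) = 16 * (2 ^ j) ^ 4`, and `(n + 1) ^ 2 ≤ 4 * n ^ 2` supplies the remaining
  -- factor 4.
  · refine ⟨Polynomial.C (64 * (2 ^ (c + 1)) ^ 4) * (2 * Polynomial.X + 1) ^ 4,
      fun x δ hδ hx => ?_⟩
    have h1 := (hLspec x.length (2 * j δ + 1)).2.2.1
    have h2 : (x.length + 1) ^ 2 * 4 ^ (2 * j δ + 1 + 1) ≤
        x.length ^ 2 * (64 * (2 ^ (c + 1)) ^ 4 * (2 ^ (lg ⌊1 / δ⌋₊)) ^ 4) := by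
      have h3 : 4 ^ (2 * j δ + 1 + 1) = 16 * ((2 ^ (c + 1)) ^ 4 * (2 ^ (lg ⌊1 / δ⌋₊)) ^ 4) := by
        rw [show (4 : ℕ) = 2 ^ 2 from rfl, show (16 : ℕ) = 2 ^ 4 from rfl, ← pow_mul, ← pow_mul,
          ← pow_mul, ← pow_add, ← pow_add]
        congr 1
        simp only [hj]
        ring
      have h4 : (x.length + 1) ^ 2 ≤ 4 * x.length ^ 2 := by nlinarith
      rw [h3]
      calc _ ≤ 4 * x.length ^ 2 * (16 * ((2 ^ (c + 1)) ^ 4 * (2 ^ (lg ⌊1 / δ⌋₊)) ^ 4)) :=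
            Nat.mul_le_mul_right _ h4
        _ = _ := by ring
    have h5 : ((L (x.length, 2 * j δ + 1)).length : ℚ) ≤
        (x.length : ℚ) ^ 2 * (64 * (2 ^ (c + 1)) ^ 4 * (2 ^ (lg ⌊1 / δ⌋₊)) ^ 4) := by
      exact_mod_cast h1.trans h2
    rw [List.length_map]
    refine h5.trans (mul_le_mul_of_nonneg_left ?_ (by positivity))
    have h6 : Polynomial.eval (1 / δ)
        (Polynomial.C (64 * (2 ^ (c + 1)) ^ 4) * (2 * Polynomial.X + 1) ^ 4 : Polynomial ℚ) =
        64 * (2 ^ (c + 1)) ^ 4 * (2 * (1 / δ) + 1) ^ 4 := by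
      simp
    rw [h6]
    exact mul_le_mul_of_nonneg_left (pow_le_pow_left₀ (by positivity) (hupp δ hδ) 4)
      (by positivity)
  · intro δ hδ
    -- This is the gap in `IsExceptional`; the double logarithm is nonnegative for `|x| ≥ 2` and is
    -- dropped.
    refine ⟨4 * j δ + 3, fun x hx hCx => ?_⟩
    have hk : kolmogorovComplexity U x + 4 * j δ + 3 ≤ x.length := by
      have h1 : (1 : ℝ) ≤ Real.logb 2 (x.length : ℝ) := by
        rw [Real.le_logb_iff_rpow_le (by norm_num) (by positivity), Real.rpow_one]
        exact_mod_cast hx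
      have h2 : 0 ≤ Real.logb 2 (Real.logb 2 (x.length : ℝ)) :=
        Real.logb_nonneg (by norm_num) h1
      have h3 : ((kolmogorovComplexity U x + 4 * j δ + 3 : ℕ) : ℝ) ≤ (x.length : ℕ) := by
        push_cast at hCx ⊢
        linarith
      exact_mod_cast h3
    have hnot : ¬ IsExceptional U L (j δ) (kolmogorovComplexity U x) x := by
      intro h
      -- If `C(x) < 2 * j`, counting leaves no room for even one exceptional string. Otherwise `C(x)
      -- = l + 2 * j`, and the short description gives `C(x) ≤ C(x) - j + c < C(x)`.
      rcases Nat.lt_or_ge (kolmogorovComplexity U x) (2 * j δ) with h1 | h1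
      · have h2 := hU.card_exceptional_lt hL (T := {x}) (by simpa using h)
        rw [Finset.card_singleton, mul_one] at h2
        have := (Nat.pow_lt_pow_iff_right (by norm_num : 1 < 2)).1 h2
        omega
      · obtain ⟨l, hl⟩ := Nat.exists_eq_add_of_le' h1
        rw [hl] at h
        have h2 := hc _ _ _ h
        have h3 : c < j δ := by simp only [hj]; omega
        omega
    simp only [IsExceptional, hk, true_and, not_le] at hnot
    simp only [countMoreComplex, List.countP_map, List.length_map]
    set M := L (x.length, 2 * j δ + 1) with hM
    have hsum := List.length_eq_countP_add_countP (l := M)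
      (p := fun s => decide (kolmogorovComplexity U (xorString x s) ≤ kolmogorovComplexity U x))
    have hcongr : M.countP ((fun y => decide (kolmogorovComplexity U x <
        kolmogorovComplexity U y)) ∘ xorString x) = M.countP fun s =>
          !decide (kolmogorovComplexity U (xorString x s) ≤ kolmogorovComplexity U x) := by
      refine List.countP_congr fun s _ => ?_
      simp
    rw [hcongr]
    simp only [decide_eq_true_eq] at hsum
    set a := M.countP fun s =>
      decide (kolmogorovComplexity U (xorString x s) ≤ kolmogorovComplexity U x)
    set b := M.countP fun s =>
      !decide (kolmogorovComplexity U (xorString x s) ≤ kolmogorovComplexity U x)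
    have hab : M.length = a + b := by
      rw [hsum]
      congr 1
      exact List.countP_congr fun s _ => by simp
    have h1 : (2 : ℚ) ^ j δ * a ≤ M.length := by exact_mod_cast hnot.le
    have h2 : 1 ≤ δ * 2 ^ j δ := by
      refine (hlow δ hδ).trans (mul_le_mul_of_nonneg_left ?_ hδ.le)
      exact pow_le_pow_right₀ (by norm_num) (Nat.le_add_right _ _)
    have h3 : (a : ℚ) ≤ δ * M.length := by
      calc (a : ℚ) = 1 * a := (one_mul _).symm
        _ ≤ δ * 2 ^ j δ * a := mul_le_mul_of_nonneg_right h2 (by positivity)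
        _ = δ * (2 ^ j δ * a) := by ring
        _ ≤ δ * M.length := mul_le_mul_of_nonneg_left h1 hδ.le
    have h4 : (M.length : ℚ) = a + b := by exact_mod_cast hab
    linarith
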